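/- All graphs are finite and simple. A tree $2$-spanner of a graph $G$ is a spanning tree $T$ of $G$ with $d_T(u,v)\le 2\,d_G(u,v)$ for all vertices $u,v$; $G$ is $2$-admissible if it has a tree $2$-spanner. $G$ is $P_4$-sparse if every set of five vertices contains at most one induced path $P_4$ on four vertices. $G$ is a thin spider if its vertex set can be partitioned into $S,K,R$ such that $K$ is a clique, $S$ is an independent set, $|S|=|K|\ge 2$, every vertex of $R$ is adjacent to all vertices of $K$ and to no vertex of $S$, and there is a bijection $f\colon S\to K$ with $N(x)=\{f(x)\}$ for all $x\in S$. **Theorem.** $2$-admissibility can be decided in $O(n)$ time for $P_4$-sparse graphs with $n$ vertices, using the degree sequence to check for a universal vertex or for the structure of a thin spider. Precisely: 1. A $P_4$-sparse graph $G$ is $2$-admissible if and only if $G$ has a universal vertex (one that is adjacent to all other vertices) or $G$ is a thin spider. 2. There is a program for a random access machine (unit cost per instruction; arithmetic only by $\pm1$, copying, comparison, indirect addressing) which, given a $P_4$-sparse graph $G$ on the vertices $0,\dots,n-1$ by adjacency lists stored with their lengths, so that $n$ and the degree of any vertex can each be read in one step, halts after $O(n)$ steps and accepts if and only if $G$ is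 $2$-admissible. The program reads nothing of $G$ but $n$ and the degrees of vertices. -/

import Mathlib

namespace Admissibility

/-! ### Graph notions -/

section Graphs

variable {V : Type*}

/-- `T` is a tree `t`-spanner of `G`: a spanning tree of `G` in which the distance between any two
vertices is at most `t` times their distance in `G`. -/
def IsTreeSpanner (G : SimpleGraph V) (t : ℕ) (T : SimpleGraph V) : Prop :=
  T ≤ G ∧ T.IsTree ∧ ∀ u v : V, T.dist u v ≤ t * G.dist u v

/-- `G` is `t`-admissible: it has a tree `t`-spanner. -/
def IsAdmissible (G : SimpleGraph V) (t : ℕ) : Prop :=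
  ∃ T : SimpleGraph V, IsTreeSpanner G t T

/-- The vertex set `s` induces a path on four vertices in `G`. -/
def InducesP4 (G : SimpleGraph V) (s : Finset V) : Prop :=
  Nonempty (G.induce (s : Set V) ≃g SimpleGraph.pathGraph 4)

/-- `G` is `P₄`-sparse: every set of five vertices contains at most one induced `P₄`. -/
def IsP4Sparse (G : SimpleGraph V) : Prop :=
  ∀ s : Finset V, s.card = 5 → {p : Finset V | p ⊆ s ∧ InducesP4 G p}.Subsingleton

/-- Some vertex of `G` is adjacent to all the other vertices. -/
def HasUniversalVertex (G : SimpleGraph V) : Prop :=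
  ∃ v : V, ∀ w : V, w ≠ v → G.Adj v w

/-- The part common to thin and thick spiders: `S`, `K`, `R` partition the vertex set, `K` is a
clique, `S` is an independent set, `|S| = |K| ≥ 2`, and every vertex of `R` is adjacent to all of
`K` and to nothing in `S`. -/
structure IsSpiderPartition (G : SimpleGraph V) (S K R : Finset V) : Prop where
  disjoint_S_K : Disjoint S K
  disjoint_S_R : Disjoint S R
  disjoint_K_R : Disjoint K R
  cover : ∀ v : V, v ∈ S ∨ v ∈ K ∨ v ∈ R
  clique : G.IsClique (K : Set V)
  indep : G.IsIndepSet (S : Set V)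
  card_eq : S.card = K.card
  two_le : 2 ≤ K.card
  adj_R_K : ∀ r ∈ R, ∀ k ∈ K, G.Adj r k
  not_adj_R_S : ∀ r ∈ R, ∀ s ∈ S, ¬ G.Adj r s

/-- `G` is a thin spider: it has a spider partition and a bijection `f : S → K` such that
`N(x) = {f x}` for all `x ∈ S`. -/
def IsThinSpider (G : SimpleGraph V) : Prop :=
  ∃ S K R : Finset V, IsSpiderPartition G S K R ∧
    ∃ f : {x // x ∈ S} ≃ {x // x ∈ K}, ∀ x, G.neighborSet x.1 = {(f x).1}

end Graphs

/-! ### The input of an algorithm -/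

/-- An adjacency list representation of a graph on the vertices `0, …, n - 1`: for each vertex, a
list of its neighbours, without repetition and in an arbitrary order. -/
structure AdjacencyLists {n : ℕ} (G : SimpleGraph (Fin n)) where
  nbrs : Fin n → List (Fin n)
  nodup : ∀ v, (nbrs v).Nodup
  mem_nbrs : ∀ v w, w ∈ nbrs v ↔ G.Adj v w

namespace AdjacencyLists

variable {n : ℕ} {G : SimpleGraph (Fin n)}

/-- The length of the list of vertex `v`, which is the degree of `v` (and `0` if there is no
vertex `v`). -/
def degreeAt (A : AdjacencyLists G) (v : ℕ) : ℕ :=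
  if h : v < n then (A.nbrs ⟨v, h⟩).length else 0

/-- Entry number `i` of the list of vertex `v` (and `0` if there is no such entry). -/
def neighborAt (A : AdjacencyLists G) (v i : ℕ) : ℕ :=
  if h : v < n then (((A.nbrs ⟨v, h⟩)[i]?).map Fin.val).getD 0 else 0

end AdjacencyLists

/-! ### Random access machines

The memory consists of the cells `X 0, X 1, X 2, …`, each holding a natural number. Every
instruction costs one step. The only arithmetic is adding and subtracting one, so all the numbers
that occur in the first `t` steps on an `n`-vertex graph are at most `n + t` plus a constant that
depends on the program only: for `t = O(n)` they fit into words of `O(log n)` bits. -/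

/-- The instructions. The graph is accessible through `order`, `degree` and `neighbor`. -/
inductive Instr where
  /-- `X d := k` -/
  | const (d k : ℕ)
  /-- `X d := X s` -/
  | copy (d s : ℕ)
  /-- `X d := X d + 1` -/
  | incr (d : ℕ)
  /-- `X d := X d - 1`, where `0 - 1 = 0` -/
  | decr (d : ℕ)
  /-- `X d := X (X s)` -/
  | load (d s : ℕ)
  /-- `X (X d) := X s` -/
  | store (d s : ℕ)
  /-- `X d :=` the number of vertices -/
  | order (d : ℕ)
  /-- `X d :=` the degree of vertex number `X v` -/
  | degree (d v : ℕ)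
  /-- `X d :=` entry number `X i` of the adjacency list of vertex number `X v` -/
  | neighbor (d v i : ℕ)
  /-- go to instruction `l` -/
  | jump (l : ℕ)
  /-- go to instruction `l` if `X a = X b` -/
  | jumpEq (a b l : ℕ)
  /-- go to instruction `l` if `X a < X b` -/
  | jumpLt (a b l : ℕ)
  /-- stop, and accept (`true`) or reject (`false`) -/
  | halt (accept : Bool)

/-- A program is a finite list of instructions, numbered from `0`. -/
abbrev Program := List Instr

/-- A configuration: the number of the next instruction, and the contents of the memory. -/
structure Config where
  pc : ℕ
  mem : ℕ → ℕ

/-- Write `x` to cell `d` and go on to the next instruction. -/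
def Config.write (c : Config) (d x : ℕ) : Config :=
  ⟨c.pc + 1, Function.update c.mem d x⟩

/-- The effect of one instruction. -/
def Instr.exec {n : ℕ} {G : SimpleGraph (Fin n)} (A : AdjacencyLists G) (c : Config) :
    Instr → Config
  | .const d k => c.write d k
  | .copy d s => c.write d (c.mem s)
  | .incr d => c.write d (c.mem d + 1)
  | .decr d => c.write d (c.mem d - 1)
  | .load d s => c.write d (c.mem (c.mem s))
  | .store d s => c.write (c.mem d) (c.mem s)
  | .order d => c.write d n
  | .degree d v => c.write d (A.degreeAt (c.mem v))
  | .neighbor d v i => c.write d (A.neighborAt (c.mem v) (c.mem i))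
  | .jump l => ⟨l, c.mem⟩
  | .jumpEq a b l => ⟨if c.mem a = c.mem b then l else c.pc + 1, c.mem⟩
  | .jumpLt a b l => ⟨if c.mem a < c.mem b then l else c.pc + 1, c.mem⟩
  | .halt _ => c

/-- The answer of the program when it is started in configuration `c`, or `none` if it does not
execute a `halt` instruction within `t` steps. -/
def Program.run (P : Program) {n : ℕ} {G : SimpleGraph (Fin n)} (A : AdjacencyLists G) :
    ℕ → Config → Option Bool
  | 0, _ => none
  | t + 1, c =>
    match P[c.pc]? with
    | none => none
    | some (.halt b) => some b
    | some I => P.run A t (I.exec A c)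

/-- The initial configuration: the first instruction is next, and all cells hold `0`. -/
def Config.init : Config := ⟨0, fun _ => 0⟩

/-- On input `A`, the program halts within `t` steps, and it accepts if and only if `p` holds. -/
def Program.DecidesWithin (P : Program) {n : ℕ} {G : SimpleGraph (Fin n)} (A : AdjacencyLists G)
    (t : ℕ) (p : Prop) : Prop :=
  ∃ b : Bool, P.run A t Config.init = some b ∧ (b = true ↔ p)

/-- The program never looks at an entry of an adjacency list: all that it can learn about the graph
is the number of vertices and the degree sequence. -/
def Program.UsesOnlyDegrees (P : Program) : Prop :=
  ∀ d v i : ℕ, Instr.neighbor d v i ∉ P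

end Admissibility

/-!
Let `T` be a tree 2-spanner of a `P₄`-sparse graph `G`, and let `w` be a vertex whose closed
neighbourhood is maximal under inclusion. If `w` is not universal, then by connectedness there is an
induced path `w x y`, and by maximality a neighbour `u` of `w` outside `N[x]`, so that `u w x y` is
an induced `C₄` or an induced `P₄`. The vertices of an induced `C₄` have a common neighbour in `T`,
whose closed neighbourhood would have to contain that of `w`, against maximality. If `u w x y` is an
induced `P₄`, then `u` and `y` have no common neighbour, since otherwise they would have one in `T`
and, applying this to that vertex, a second one adjacent to it, which makes a triangle in the tree.
By `P₄`-sparseness `w` is then the only neighbour of `u`. Finally, a connected `P₄`-sparse graph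
with a pendant vertex attached to a non-universal vertex `w` is a thin spider: every vertex outside
`N[w]` is the other end of an induced `P₄` that starts with the pendant vertex, and hence pendant.

As for the degrees, let `k` be the number of vertices of degree `1`. In a thin spider these vertices
form `S`, and those of `K` have degree `n - k`. Conversely, a vertex of degree `n - k ≠ 1` has a
neighbour of degree `1`, so if there are at least `k` such vertices, then each has exactly one, and
therefore is adjacent to all the vertices of degree other than `1`. Hence it suffices to count three
times the vertices of a given degree: `n - 1`, then `1`, then `n - k`.
-/

namespace Admissibility

section ClosedNeighborhood

variable {V : Type*} {G H : SimpleGraph V} {u v : V}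

/-- The closed neighbourhood of `v`: the vertex `v` together with its neighbours. -/
def closedNbhd (G : SimpleGraph V) (v : V) : Set V :=
  insert v (G.neighborSet v)

theorem mem_closedNbhd : u ∈ closedNbhd G v ↔ u = v ∨ G.Adj v u :=
  Iff.rfl

theorem self_mem_closedNbhd : v ∈ closedNbhd G v :=
  Set.mem_insert v _

theorem closedNbhd_mono (h : G ≤ H) (v : V) : closedNbhd G v ⊆ closedNbhd H v :=
  Set.insert_subset_insert fun _ hv => h hv

end ClosedNeighborhood

/-! ### Tree 2-spanners -/

section Trees

variable {V : Type*} {G T : SimpleGraph V}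

theorem length_eq_dist_of_isChain (hT : T.IsAcyclic) {u v : V} (p : T.Walk u v)
    (hp : p.edges.IsChain (· ≠ ·)) : p.length = T.dist u v := by
  obtain ⟨q, hq, hlength⟩ := p.reachable.exists_path_of_dist
  have hpq := (hT.subsingleton_path u v).elim ⟨p, (hT.isPath_iff_isChain p).2 hp⟩ ⟨q, hq⟩
  rw [← hlength, congrArg (fun r : T.Path u v => r.1.length) hpq]

/-- The induced cycle of length four with edges `ab`, `bc`, `cd`, `da`. -/
structure IsInducedC4 (G : SimpleGraph V) (a b c d : V) : Prop where
  ab : G.Adj a b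
  bc : G.Adj b c
  cd : G.Adj c d
  da : G.Adj d a
  ac : ¬ G.Adj a c
  bd : ¬ G.Adj b d
  ac_ne : a ≠ c
  bd_ne : b ≠ d

theorem IsInducedC4.rotate {a b c d : V} (h : IsInducedC4 G a b c d) : IsInducedC4 G b c d a :=
  ⟨h.bc, h.cd, h.da, h.ab, h.bd, fun hca => h.ac hca.symm, h.bd_ne, h.ac_ne.symm⟩

namespace IsTreeSpanner

theorem dist_le {t : ℕ} (h : IsTreeSpanner G t T) {u v : V} (huv : G.Adj u v) :
    T.dist u v ≤ t := by
  simpa [SimpleGraph.dist_eq_one_iff_adj.2 huv] using h.2.2 u v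

theorem length_le_of_isChain {t : ℕ} (h : IsTreeSpanner G t T) {u v : V} (huv : G.Adj u v)
    (p : T.Walk u v) (hp : p.edges.IsChain (· ≠ ·)) : p.length ≤ t :=
  (length_eq_dist_of_isChain h.2.1.isAcyclic p hp).trans_le (h.dist_le huv)

theorem adj_or_exists_adj_adj (h : IsTreeSpanner G 2 T) {u v : V} (huv : G.Adj u v) :
    T.Adj u v ∨ ∃ m, T.Adj u m ∧ T.Adj m v := by
  obtain ⟨p, hp⟩ := h.2.1.connected.exists_walk_length_eq_dist u v
  have hlength : p.length ≤ 2 := hp.trans_le (h.dist_le huv)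
  match p, hlength with
  | .nil, _ => exact absurd huv G.irrefl
  | .cons hum .nil, _ => exact .inl hum
  | .cons hum (.cons hmv .nil), _ => exact .inr ⟨_, hum, hmv⟩
  | .cons _ (.cons _ (.cons _ _)), hlength => simp at hlength

theorem commonNeighbors_subset_closedNbhd (h : IsTreeSpanner G 2 T) {p a b : V}
    (hpa : T.Adj p a) (hpb : T.Adj p b) (hab : a ≠ b) :
    G.commonNeighbors a b ⊆ closedNbhd T p := by
  rintro u ⟨hau, hbu⟩
  rw [mem_closedNbhd]
  by_contra! hu
  rcases h.adj_or_exists_adj_adj hau with hau' | ⟨m, ham, hmu⟩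
  · simpa using h.length_le_of_isChain hbu
      (.cons hpb.symm (.cons hpa (.cons hau' .nil))) (by simp [hpa.ne, hab.symm, hu.1.symm])
  · have hmp : m ≠ p := fun hmp => hu.2 (hmp ▸ hmu)
    simpa using h.length_le_of_isChain hbu
      (.cons hpb.symm (.cons hpa (.cons ham (.cons hmu .nil))))
      (by simp [hpa.ne, ham.ne, hab.symm, hmp.symm, hau.ne])

theorem not_adj_of_isInducedC4 (h : IsTreeSpanner G 2 T) {a b c d : V}
    (hC : IsInducedC4 G a b c d) : ¬ T.Adj a b := by
  intro hab
  rcases h.adj_or_exists_adj_adj hC.bc with hbc | ⟨m, hbm, hmc⟩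
  · rcases h.commonNeighbors_subset_closedNbhd hab.symm hbc hC.ac_ne ⟨hC.da.symm, hC.cd⟩ with
      hdb | hbd
    exacts [hC.bd_ne hdb.symm, hC.bd (h.1 hbd)]
  · have ham : a ≠ m := fun ham => hC.ac (h.1 (ham ▸ hmc))
    rcases h.adj_or_exists_adj_adj hC.da with hda | ⟨k, hdk, hka⟩
    · simpa using h.length_le_of_isChain hC.cd.symm
        (.cons hda (.cons hab (.cons hbm (.cons hmc .nil))))
        (by simp [hC.bd_ne.symm, hda.ne, ham, hab.ne, hC.bc.ne, hbm.ne])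
    · have hkb : k ≠ b := fun hkb => hC.bd (h.1 (hkb ▸ hdk.symm))
      simpa using h.length_le_of_isChain hC.cd.symm
        (.cons hdk (.cons hka (.cons hab (.cons hbm (.cons hmc .nil)))))
        (by simp [hC.da.ne, hdk.ne, hkb, hka.ne, ham, hab.ne, hC.bc.ne, hbm.ne])

theorem adj_of_isInducedC4 (h : IsTreeSpanner G 2 T) {a b c d p : V} (hC : IsInducedC4 G a b c d)
    (hpa : T.Adj p a) (hpb : T.Adj p b) (hpc : T.Adj p c) : T.Adj p d := by
  rcases h.commonNeighbors_subset_closedNbhd hpa hpc hC.ac_ne ⟨hC.da.symm, hC.cd⟩ with rfl | hpd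
  exacts [absurd (h.1 hpb.symm) hC.bd, hpd]

theorem exists_center_of_isInducedC4 (h : IsTreeSpanner G 2 T) {a b c d : V}
    (hC : IsInducedC4 G a b c d) : ∃ p, T.Adj p a ∧ T.Adj p b ∧ T.Adj p c ∧ T.Adj p d := by
  obtain ⟨k, hak, hkb⟩ :=
    (h.adj_or_exists_adj_adj hC.ab).resolve_left (h.not_adj_of_isInducedC4 hC)
  obtain ⟨l, hbl, hlc⟩ :=
    (h.adj_or_exists_adj_adj hC.bc).resolve_left (h.not_adj_of_isInducedC4 hC.rotate)
  obtain ⟨m, hcm, hmd⟩ :=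
    (h.adj_or_exists_adj_adj hC.cd).resolve_left (h.not_adj_of_isInducedC4 hC.rotate.rotate)
  by_cases hkl : k = l
  · subst hkl
    exact ⟨k, hak.symm, hkb, hlc, h.adj_of_isInducedC4 hC hak.symm hkb hlc⟩
  by_cases hlm : l = m
  · subst hlm
    exact ⟨l, h.adj_of_isInducedC4 hC.rotate hbl.symm hlc hmd, hbl.symm, hlc, hmd⟩
  · have hlength := h.length_le_of_isChain hC.da.symm
      (.cons hak (.cons hkb (.cons hbl (.cons hlc (.cons hcm (.cons hmd .nil))))))
      (by simp [hC.ab.ne, hak.ne, hkl, hkb.ne, hC.bc.ne, hbl.ne, hlm, hlc.ne, hC.cd.ne, hcm.ne])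
    simp at hlength

theorem adj_or_adj_of_mem_commonNeighbors (h : IsTreeSpanner G 2 T) {x y z : V}
    (hxy : T.Adj x y) (hz : z ∈ G.commonNeighbors x y) : T.Adj x z ∨ T.Adj y z := by
  rcases h.adj_or_exists_adj_adj hz.1 with hxz | ⟨m, hxm, hmz⟩
  · exact .inl hxz
  by_cases hmy : m = y
  · exact .inr (hmy ▸ hmz)
  · simpa using h.length_le_of_isChain hz.2 (.cons hxy.symm (.cons hxm (.cons hmz .nil)))
      (by simp [hxy.ne', Ne.symm hmy, hxm.ne, hz.1.ne])

theorem exists_center_of_triangle (h : IsTreeSpanner G 2 T) {x y z : V} (hxy : G.Adj x y)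
    (hyz : G.Adj y z) (hxz : G.Adj x z) :
    ∃ p, x ∈ closedNbhd T p ∧ y ∈ closedNbhd T p ∧ z ∈ closedNbhd T p := by
  simp only [mem_closedNbhd]
  have of_adj : ∀ {x y z : V}, T.Adj x y → G.Adj y z → G.Adj x z →
      (T.Adj x y ∧ T.Adj x z) ∨ (T.Adj y x ∧ T.Adj y z) := fun hxy hyz hxz =>
    (h.adj_or_adj_of_mem_commonNeighbors hxy ⟨hxz, hyz⟩).imp (⟨hxy, ·⟩) (⟨hxy.symm, ·⟩)
  rcases h.adj_or_exists_adj_adj hxy with hxy' | ⟨m, hxm, hmy⟩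
  · rcases of_adj hxy' hyz hxz with hx | hy
    exacts [⟨x, by simp [hx]⟩, ⟨y, by simp [hy]⟩]
  rcases h.adj_or_exists_adj_adj hyz with hyz' | ⟨k, hyk, hkz⟩
  · rcases of_adj hyz' hxz.symm hxy.symm with hy | hz
    exacts [⟨y, by simp [hy]⟩, ⟨z, by simp [hz]⟩]
  by_cases hmk : m = k
  · subst hmk
    exact ⟨m, .inr hxm.symm, .inr hmy, .inr hkz⟩
  · simpa using h.length_le_of_isChain hxz
      (.cons hxm (.cons hmy (.cons hyk (.cons hkz .nil))))
      (by simp [hxy.ne, hxm.ne, hmk, hmy.ne, hyz.ne, hyk.ne])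

/-- The six vertices need not induce a sun: nothing is said about edges between the outer ones. -/
theorem exists_center_of_sun (h : IsTreeSpanner G 2 T) {x y z x' y' z' : V}
    (hxy : G.Adj x y) (hyz : G.Adj y z) (hxz : G.Adj x z)
    (hx' : x' ∈ G.commonNeighbors y z \ closedNbhd G x)
    (hy' : y' ∈ G.commonNeighbors x z \ closedNbhd G y)
    (hz' : z' ∈ G.commonNeighbors x y \ closedNbhd G z) :
    ∃ p, T.Adj p z ∧ T.Adj p x' ∧ T.Adj p y' := by
  obtain ⟨p, hx, hy, hz⟩ := h.exists_center_of_triangle hxy hyz hxz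
  have ne_center : ∀ {x y z x' : V}, y ≠ z → x ≠ y → x ≠ z → y ∈ closedNbhd T p →
      z ∈ closedNbhd T p → x' ∈ G.commonNeighbors y z \ closedNbhd G x → x ≠ p := by
    rintro x y z x' hyz hxy hxz hy hz hx' rfl
    exact hx'.2 <| closedNbhd_mono h.1 x <|
      h.commonNeighbors_subset_closedNbhd (hy.resolve_left hxy.symm) (hz.resolve_left hxz.symm)
        hyz hx'.1
  replace hx := hx.resolve_left (ne_center hyz.ne hxy.ne hxz.ne hy hz hx')
  replace hy := hy.resolve_left (ne_center hxz.ne hxy.ne' hyz.ne (.inr hx) hz hy')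
  replace hz := hz.resolve_left (ne_center hxy.ne hxz.ne' hyz.ne' (.inr hx) (.inr hy) hz')
  refine ⟨p, hz, ?_, ?_⟩
  · refine (h.commonNeighbors_subset_closedNbhd hy hz hyz.ne hx'.1).resolve_left ?_
    rintro rfl
    exact hx'.2 (.inr (h.1 hx.symm))
  · refine (h.commonNeighbors_subset_closedNbhd hx hz hxz.ne hy'.1).resolve_left ?_
    rintro rfl
    exact hy'.2 (.inr (h.1 hy.symm))

end IsTreeSpanner

end Trees

/-! ### `P₄`-sparse graphs -/

section InducedPaths

variable {V : Type*} {G : SimpleGraph V}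

/-- The induced path with edges `ab`, `bc`, `cd`. -/
structure IsInducedP4 (G : SimpleGraph V) (a b c d : V) : Prop where
  ab : G.Adj a b
  bc : G.Adj b c
  cd : G.Adj c d
  ac : ¬ G.Adj a c
  bd : ¬ G.Adj b d
  ad : ¬ G.Adj a d

namespace IsInducedP4

variable {a b c d : V}

theorem reverse (h : IsInducedP4 G a b c d) : IsInducedP4 G d c b a :=
  ⟨h.cd.symm, h.bc.symm, h.ab.symm, fun hdb => h.bd hdb.symm, fun hca => h.ac hca.symm,
    fun hda => h.ad hda.symm⟩

theorem ac_ne (h : IsInducedP4 G a b c d) : a ≠ c :=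
  fun hac => h.ad (hac ▸ h.cd)

theorem bd_ne (h : IsInducedP4 G a b c d) : b ≠ d :=
  fun hbd => h.ad (hbd ▸ h.ab)

theorem ad_ne (h : IsInducedP4 G a b c d) : a ≠ d :=
  fun had => h.ac (had ▸ h.cd.symm)

theorem card_eq [DecidableEq V] (h : IsInducedP4 G a b c d) :
    ({a, b, c, d} : Finset V).card = 4 := by
  simp [Finset.card_insert_of_notMem, h.ab.ne, h.bc.ne, h.cd.ne, h.ac_ne, h.bd_ne, h.ad_ne]

theorem injective (h : IsInducedP4 G a b c d) : Function.Injective ![a, b, c, d] := by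
  rw [← List.nodup_ofFn]
  simp [List.ofFn_succ, h.ab.ne, h.bc.ne, h.cd.ne, h.ac_ne, h.bd_ne, h.ad_ne]

/-- The embedding of the path on four vertices given by an induced path. -/
def embedding (h : IsInducedP4 G a b c d) : SimpleGraph.pathGraph 4 ↪g G where
  toFun := ![a, b, c, d]
  inj' := h.injective
  map_rel_iff' {i j} := by
    fin_cases i <;> fin_cases j <;>
      simp [SimpleGraph.pathGraph_adj, h.ab, h.bc, h.cd, h.ac, h.bd, h.ad, h.ab.symm, h.bc.symm,
        h.cd.symm, h.reverse.ac, h.reverse.bd, h.reverse.ad]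

theorem inducesP4 [DecidableEq V] (h : IsInducedP4 G a b c d) : InducesP4 G {a, b, c, d} := by
  have hrange : Set.range h.embedding = (({a, b, c, d} : Finset V) : Set V) := by
    change Set.range ![a, b, c, d] = _
    ext v
    simp [eq_comm, or_comm, or_left_comm]
  rw [InducesP4, ← hrange]
  exact ⟨h.embedding.isoInduceRange.symm⟩

end IsInducedP4

namespace IsP4Sparse

variable {a b c d x : V}

theorem not_isInducedP4 (hG : IsP4Sparse G) (h : IsInducedP4 G a b c d) (hx : x ∉ [a, b, c, d])
    {p q r s : V} (hmem : x ∈ [p, q, r, s]) (hsub : [p, q, r, s] ⊆ [x, a, b, c, d]) :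
    ¬ IsInducedP4 G p q r s := by
  classical
  intro h'
  have hcard : (insert x {a, b, c, d} : Finset V).card = 5 := by
    rw [Finset.card_insert_of_notMem (by simpa using hx), h.card_eq]
  have hsub' : ({p, q, r, s} : Finset V) ⊆ insert x {a, b, c, d} := by
    simpa [Finset.subset_iff] using hsub
  have heq := hG _ hcard ⟨Finset.subset_insert _ _, h.inducesP4⟩ ⟨hsub', h'.inducesP4⟩
  have : x ∈ ({a, b, c, d} : Finset V) := heq ▸ by simpa using hmem
  exact hx (by simpa using this)

theorem adj_third_of_adj_second (hG : IsP4Sparse G) (h : IsInducedP4 G a b c d)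
    (hx : x ∉ [a, b, c, d]) (hxb : G.Adj x b) : G.Adj x c := by
  by_contra hxc
  by_cases hxd : G.Adj x d
  · by_cases hxa : G.Adj x a
    · exact hG.not_isInducedP4 h hx (p := c) (q := d) (r := x) (s := a) (by simp) (by simp)
        ⟨h.cd, hxd.symm, hxa, fun hcx => hxc hcx.symm, h.reverse.ad, h.reverse.bd⟩
    · exact hG.not_isInducedP4 h hx (p := a) (q := b) (r := x) (s := d) (by simp) (by simp)
        ⟨h.ab, hxb.symm, hxd, fun hax => hxa hax.symm, h.bd, h.ad⟩
  · exact hG.not_isInducedP4 h hx (p := x) (q := b) (r := c) (s := d) (by simp) (by simp)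
      ⟨hxb, h.bc, h.cd, hxc, h.bd, hxd⟩

theorem adj_second_iff_adj_third (hG : IsP4Sparse G) (h : IsInducedP4 G a b c d)
    (hx : x ∉ [a, b, c, d]) : G.Adj x b ↔ G.Adj x c :=
  ⟨hG.adj_third_of_adj_second h hx,
    hG.adj_third_of_adj_second h.reverse (by grind)⟩

theorem adj_second_of_adj_first (hG : IsP4Sparse G) (h : IsInducedP4 G a b c d)
    (hx : x ∉ [a, b, c, d]) (hxa : G.Adj x a) : G.Adj x b := by
  by_contra hxb
  have hxc : ¬ G.Adj x c := (hG.adj_second_iff_adj_third h hx).not.1 hxb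
  exact hG.not_isInducedP4 h hx (p := x) (q := a) (r := b) (s := c) (by simp) (by simp)
    ⟨hxa, h.ab, h.bc, hxb, h.ac, hxc⟩

theorem adj_fourth_of_adj_first (hG : IsP4Sparse G) (h : IsInducedP4 G a b c d)
    (hx : x ∉ [a, b, c, d]) (hxa : G.Adj x a) : G.Adj x d := by
  by_contra hxd
  have hxc : G.Adj x c :=
    hG.adj_third_of_adj_second h hx (hG.adj_second_of_adj_first h hx hxa)
  exact hG.not_isInducedP4 h hx (p := a) (q := x) (r := c) (s := d) (by simp) (by simp)
    ⟨hxa.symm, hxc, h.cd, h.ac, hxd, h.ad⟩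

theorem adj_first_iff_adj_fourth (hG : IsP4Sparse G) (h : IsInducedP4 G a b c d)
    (hx : x ∉ [a, b, c, d]) : G.Adj x a ↔ G.Adj x d :=
  ⟨hG.adj_fourth_of_adj_first h hx,
    hG.adj_fourth_of_adj_first h.reverse (by grind)⟩

theorem mem_commonNeighbors_first_fourth (hG : IsP4Sparse G) (h : IsInducedP4 G a b c d)
    (hxa : G.Adj x a) (hxb : x ≠ b) : x ∈ G.commonNeighbors a d := by
  have hx : x ∉ [a, b, c, d] := by
    have hxc : x ≠ c := fun hxc => h.ac (hxc ▸ hxa.symm)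
    have hxd : x ≠ d := fun hxd => h.ad (hxd ▸ hxa.symm)
    simp [hxa.ne, hxb, hxc, hxd]
  exact ⟨hxa.symm, ((hG.adj_first_iff_adj_fourth h hx).1 hxa).symm⟩

theorem neighborSet_first_eq (hG : IsP4Sparse G) (h : IsInducedP4 G a b c d)
    (had : G.commonNeighbors a d = ∅) : G.neighborSet a = {b} := by
  refine Set.eq_singleton_iff_unique_mem.2 ⟨h.ab, fun x hx => ?_⟩
  by_contra hxb
  exact had.subset (hG.mem_commonNeighbors_first_fourth h hx.symm hxb)

end IsP4Sparse

end InducedPaths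

/-! ### Thin spiders -/

section ThinSpiders

variable {V : Type*} {G : SimpleGraph V} {S : Set V} {f : V → V}

/-- `S` is the independent part of a thin spider and `f` sends each `s ∈ S` to its only neighbour.
The clique is the image of `S` under `f`, and the remaining vertices form the part `R`. -/
structure IsLegMap (G : SimpleGraph V) (S : Set V) (f : V → V) : Prop where
  nontrivial : S.Nontrivial
  injOn : S.InjOn f
  notMem : ∀ s ∈ S, f s ∉ S
  neighborSet_eq : ∀ s ∈ S, G.neighborSet s = {f s}
  adj : ∀ s ∈ S, ∀ v ∉ S, v ≠ f s → G.Adj v (f s)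

theorem IsThinSpider.exists_isLegMap (hG : IsThinSpider G) : ∃ S f, IsLegMap G S f := by
  obtain ⟨S, K, R, hSKR, e, he⟩ := hG
  have exists_eq : ∀ s ∈ S, ∃ k, ∃ hs, k = (e ⟨s, hs⟩).1 := fun s hs => ⟨_, hs, rfl⟩
  choose! f hf using exists_eq
  have mem_clique : ∀ s ∈ S, f s ∈ K := fun s hs => by
    obtain ⟨_, hfs⟩ := hf s hs
    exact hfs ▸ (e _).2
  refine ⟨S, f, ?_, ?_, ?_, ?_, ?_⟩
  · exact Finset.one_lt_card_iff_nontrivial.1 (hSKR.card_eq ▸ hSKR.two_le)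
  · intro s hs t ht hst
    obtain ⟨_, hfs⟩ := hf s hs
    obtain ⟨_, hft⟩ := hf t ht
    simpa using e.injective (Subtype.ext (hfs.symm.trans (hst.trans hft)))
  · exact fun s hs hfs => Finset.disjoint_left.1 hSKR.disjoint_S_K hfs (mem_clique s hs)
  · intro s hs
    obtain ⟨_, hfs⟩ := hf s hs
    exact hfs ▸ he ⟨s, hs⟩
  · intro s hs v hv hne
    rcases hSKR.cover v with hvS | hvK | hvR
    exacts [absurd hvS hv, hSKR.clique hvK (mem_clique s hs) hne,
      hSKR.adj_R_K v hvR _ (mem_clique s hs)]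

namespace IsLegMap

theorem eq_of_adj (h : IsLegMap G S f) {s v : V} (hs : s ∈ S) (hsv : G.Adj s v) : v = f s :=
  (h.neighborSet_eq s hs).subset hsv

theorem adj_apply (h : IsLegMap G S f) {s : V} (hs : s ∈ S) : G.Adj s (f s) :=
  (h.neighborSet_eq s hs).superset rfl

theorem isSpiderPartition [Fintype V] [DecidableEq V] (h : IsLegMap G S f) [Fintype S] :
    IsSpiderPartition G S.toFinset (S.toFinset.image f) (S.toFinset ∪ S.toFinset.image f)ᶜ where
  disjoint_S_K := by
    simpa [Finset.disjoint_right] using h.notMem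
  disjoint_S_R := by
    rw [disjoint_compl_right_iff]
    exact Finset.subset_union_left
  disjoint_K_R := by
    rw [disjoint_compl_right_iff]
    exact Finset.subset_union_right
  cover v := by
    simp only [Finset.mem_compl, Finset.mem_union]
    tauto
  clique := by
    simp only [Finset.coe_image, Set.coe_toFinset]
    rintro _ ⟨s, hs, rfl⟩ _ ⟨t, ht, rfl⟩ hne
    exact h.adj t ht (f s) (h.notMem s hs) hne
  indep := by
    rw [Set.coe_toFinset]
    intro s hs t ht _ hst
    exact h.notMem s hs (h.eq_of_adj hs hst ▸ ht)
  card_eq := (Finset.card_image_of_injOn (by simpa using h.injOn)).symm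
  two_le := by
    rw [Finset.card_image_of_injOn (by simpa using h.injOn), Nat.succ_le_iff,
      Finset.one_lt_card_iff_nontrivial, Set.toFinset_nontrivial]
    exact h.nontrivial
  adj_R_K r hr k hk := by
    simp only [Finset.mem_compl, Finset.mem_union, Finset.mem_image, Set.mem_toFinset, not_or,
      not_exists, not_and] at hr hk
    obtain ⟨s, hs, rfl⟩ := hk
    exact h.adj s hs r hr.1 fun hrs => hr.2 s hs hrs.symm
  not_adj_R_S r hr s hs hrs := by
    simp only [Finset.mem_compl, Finset.mem_union, Finset.mem_image, Set.mem_toFinset, not_or,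
      not_exists, not_and] at hr hs
    exact hr.2 s hs (h.eq_of_adj hs hrs.symm).symm

theorem isThinSpider [Finite V] (h : IsLegMap G S f) : IsThinSpider G := by
  classical
  cases nonempty_fintype V
  have bijOn : Set.BijOn f (S.toFinset : Set V) (S.toFinset.image f : Set V) := by
    simpa using h.injOn.bijOn_image
  exact ⟨_, _, _, h.isSpiderPartition, bijOn.equiv f,
    fun s => h.neighborSet_eq s.1 (Set.mem_toFinset.1 s.2)⟩

end IsLegMap

end ThinSpiders

section Pendant

variable {V : Type*} {G : SimpleGraph V} {a b x y : V}

theorem exists_adj_of_mem_of_notMem (hG : G.Preconnected) {A : Set V} {u v : V} (hu : u ∈ A)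
    (hv : v ∉ A) : ∃ x ∈ A, ∃ y ∉ A, G.Adj x y := by
  obtain ⟨p⟩ := hG u v
  obtain ⟨d, -, hfst, hsnd⟩ := p.exists_boundary_dart A hu hv
  exact ⟨d.fst, hfst, d.snd, hsnd, d.adj⟩

theorem isInducedP4_of_neighborSet_eq_singleton (ha : G.neighborSet a = {b}) (hbx : G.Adj b x)
    (hxy : G.Adj x y) (hy : y ∉ closedNbhd G b) : IsInducedP4 G a b x y := by
  have eq_of_adj : ∀ {v}, G.Adj a v → v = b := fun hav => ha.subset hav
  exact ⟨ha.superset rfl, hbx, hxy, fun hax => hbx.ne' (eq_of_adj hax), fun hby => hy (.inr hby),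
    fun hay => hy (.inl (eq_of_adj hay))⟩

namespace IsP4Sparse

theorem neighborSet_fourth_eq (hG : IsP4Sparse G) (h : IsInducedP4 G a b x y)
    (ha : G.neighborSet a = {b}) : G.neighborSet y = {x} := by
  refine hG.neighborSet_first_eq h.reverse (Set.eq_empty_of_forall_notMem ?_)
  rintro v ⟨hyv, hav⟩
  obtain rfl : v = b := ha.subset hav
  exact h.bd hyv.symm

theorem fourth_unique (hG : IsP4Sparse G) {y' : V} (h : IsInducedP4 G a b x y)
    (h' : IsInducedP4 G a b x y') : y = y' := by
  by_contra hne
  have hy' : y' ∉ [a, b, x, y] := by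
    simp [h'.ad_ne.symm, h'.bd_ne.symm, h'.cd.ne', Ne.symm hne]
  exact h'.bd ((hG.adj_second_iff_adj_third h hy').2 h'.cd.symm).symm

theorem exists_isInducedP4_of_pendant (hG : IsP4Sparse G) (hconn : G.Preconnected)
    (ha : G.neighborSet a = {b}) (hy : y ∉ closedNbhd G b) : ∃ x, IsInducedP4 G a b x y := by
  by_contra hyP
  obtain ⟨u, hu, v, hv, huv⟩ := exists_adj_of_mem_of_notMem hconn
    (A := {v | v ∈ closedNbhd G b ∨ ∃ x, IsInducedP4 G a b x v}) (u := b)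
    (.inl self_mem_closedNbhd) (not_or.2 ⟨hy, hyP⟩)
  obtain ⟨hvb, hvP⟩ := not_or.1 hv
  rcases hu with (rfl | hbu) | ⟨x, hx⟩
  · exact hvb (.inr huv)
  · exact hvP ⟨u, isInducedP4_of_neighborSet_eq_singleton ha hbu huv hvb⟩
  · obtain rfl : v = x := (hG.neighborSet_fourth_eq hx ha).subset huv
    exact hvb (.inr hx.bc)

theorem exists_isLegMap_of_pendant (hG : IsP4Sparse G) (hconn : G.Preconnected)
    (ha : G.neighborSet a = {b}) (hb : ∃ y, y ∉ closedNbhd G b) : ∃ S f, IsLegMap G S f := by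
  have hab : G.Adj a b := ha.superset rfl
  have exists_body : ∀ s ∈ insert a (closedNbhd G b)ᶜ,
      ∃ k, (s = a ∧ k = b) ∨ IsInducedP4 G a b k s := by
    rintro s (rfl | hs)
    · exact ⟨b, .inl ⟨rfl, rfl⟩⟩
    · exact (hG.exists_isInducedP4_of_pendant hconn ha hs).imp fun _ => .inr
  choose! f hf using exists_body
  refine ⟨insert a (closedNbhd G b)ᶜ, f, ?_, ?_, ?_, ?_, ?_⟩
  · obtain ⟨y, hy⟩ := hb
    exact ⟨a, .inl rfl, y, .inr hy, fun hay => hy (hay ▸ .inr hab.symm)⟩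
  · intro s hs t ht hst
    rcases hf s hs with ⟨hsa, hfs⟩ | hPs <;> rcases hf t ht with ⟨hta, hft⟩ | hPt
    · exact hsa.trans hta.symm
    · exact absurd (hfs.symm.trans hst) hPt.bc.ne
    · exact absurd (hft.symm.trans hst.symm) hPs.bc.ne
    · exact hG.fourth_unique hPs (hst ▸ hPt)
  · intro s hs
    simp only [Set.mem_insert_iff, Set.mem_compl_iff, mem_closedNbhd, not_or, not_and_or]
    rcases hf s hs with ⟨-, hfs⟩ | hP
    · simp [hfs, hab.ne']
    · simp [hP.ac_ne.symm, hP.bc]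
  · intro s hs
    rcases hf s hs with ⟨rfl, hfs⟩ | hP
    exacts [hfs ▸ ha, hG.neighborSet_fourth_eq hP ha]
  · intro s hs v hv hne
    obtain ⟨hva, hvb⟩ : v ≠ a ∧ v ∈ closedNbhd G b := by simpa using hv
    rcases hf s hs with ⟨-, hfs⟩ | hP
    · rw [hfs] at hne ⊢
      exact (hvb.resolve_left hne).symm
    rcases hvb with rfl | hbv
    · exact hP.bc
    have hvs : v ≠ s := fun hvs => hP.bd (hvs ▸ hbv)
    exact (hG.adj_second_iff_adj_third hP (by simp [hva, hbv.ne', hne, hvs])).1 hbv.symm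

theorem hasUniversalVertex_or_isThinSpider_of_pendant [Finite V] (hG : IsP4Sparse G)
    (hconn : G.Preconnected) (ha : G.neighborSet a = {b}) :
    HasUniversalVertex G ∨ IsThinSpider G := by
  by_cases hb : ∃ y, y ∉ closedNbhd G b
  · obtain ⟨S, f, hS⟩ := hG.exists_isLegMap_of_pendant hconn ha hb
    exact .inr hS.isThinSpider
  · push Not at hb
    exact .inl ⟨b, fun v hvb => (hb v).resolve_left hvb⟩

end IsP4Sparse

end Pendant

section Maximality

variable {V : Type*} {G T : SimpleGraph V} {u w x y : V}

/-- The closed neighbourhood of `w` is maximal under inclusion among the closed neighbourhoods of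
vertices. A universal vertex is of this kind; the argument starts from such a `w` and looks at what
happens when it is not universal. -/
def IsClosedNbhdMaximal (G : SimpleGraph V) (w : V) : Prop :=
  ∀ z, closedNbhd G w ⊆ closedNbhd G z → closedNbhd G z ⊆ closedNbhd G w

theorem exists_isClosedNbhdMaximal [Finite V] [Nonempty V] (G : SimpleGraph V) :
    ∃ w, IsClosedNbhdMaximal G w := by
  obtain ⟨w, hw⟩ := Set.finite_univ.exists_maximalFor (closedNbhd G) Set.univ Set.univ_nonempty
  exact ⟨w, fun z => hw.2 (Set.mem_univ z)⟩

theorem IsClosedNbhdMaximal.exists_adj_notMem (hw : IsClosedNbhdMaximal G w) {z : V}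
    (hwz : G.Adj w z) (hzy : G.Adj z y) (hy : y ∉ closedNbhd G w) :
    ∃ v, G.Adj w v ∧ v ∉ closedNbhd G z := by
  have hsub : ¬ closedNbhd G w ⊆ closedNbhd G z := fun hsub => hy (hw z hsub (.inr hzy))
  obtain ⟨v, hv, hvz⟩ := Set.not_subset.1 hsub
  refine ⟨v, hv.resolve_left ?_, hvz⟩
  rintro rfl
  exact hvz (.inr hwz.symm)

theorem IsP4Sparse.adj_of_isInducedC4 (hG : IsP4Sparse G) (hC : IsInducedC4 G u w x y) {v : V}
    (hwv : G.Adj w v) (hvx : v ≠ x) (hvy : ¬ G.Adj v y) : G.Adj v u := by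
  by_contra hvu
  have hP : IsInducedP4 G v w u y := ⟨hwv.symm, hC.ab.symm, hC.da.symm, hvu, hC.bd, hvy⟩
  have hx : x ∉ [v, w, u, y] := by simp [hvx.symm, hC.bc.ne', hC.ac_ne.symm, hC.cd.ne]
  exact hC.ac ((hG.adj_second_iff_adj_third hP hx).1 hC.bc.symm).symm

namespace IsTreeSpanner

theorem not_isInducedC4_of_isClosedNbhdMaximal (h : IsTreeSpanner G 2 T) (hG : IsP4Sparse G)
    (hw : IsClosedNbhdMaximal G w) : ¬ IsInducedC4 G u w x y := by
  intro hC
  obtain ⟨p, hpu, hpw, hpx, hpy⟩ := h.exists_center_of_isInducedC4 hC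
  obtain ⟨v, hwv, hvp⟩ := hw.exists_adj_notMem (h.1 hpw.symm) (h.1 hpy)
    (not_or.2 ⟨hC.bd_ne.symm, hC.bd⟩)
  have ne_of_adj : ∀ {q}, T.Adj p q → v ≠ q := fun hpq hvq => hvp (hvq ▸ .inr (h.1 hpq))
  obtain ⟨hvp_ne, hpv⟩ := not_or.1 hvp
  by_cases hvy : G.Adj v y
  · exact h.not_adj_of_isInducedC4
      ⟨h.1 hpw, hwv, hvy, h.1 hpy.symm, hpv, hC.bd, Ne.symm hvp_ne, hC.bd_ne⟩ hpw
  · have hvu : G.Adj v u := hG.adj_of_isInducedC4 hC hwv (ne_of_adj hpx) hvy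
    have hvx : G.Adj v x := hG.adj_of_isInducedC4
      ⟨hC.bc.symm, hC.ab.symm, hC.da.symm, hC.cd.symm, fun hxu => hC.ac hxu.symm, hC.bd,
        hC.ac_ne.symm, hC.bd_ne⟩ hwv (ne_of_adj hpu) hvy
    exact h.not_adj_of_isInducedC4
      ⟨h.1 hpu, hvu.symm, hvx, h.1 hpx.symm, hpv, hC.ac, Ne.symm hvp_ne, hC.ac_ne⟩ hpu

theorem exists_center_of_mem_commonNeighbors (h : IsTreeSpanner G 2 T) (hG : IsP4Sparse G)
    (hw : IsClosedNbhdMaximal G w) (hP : IsInducedP4 G u w x y) {f : V}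
    (hf : f ∈ G.commonNeighbors u y) : ∃ p, T.Adj p u ∧ T.Adj p f ∧ T.Adj p y := by
  obtain ⟨huf, hyf⟩ := hf
  have hfP : f ∉ [u, w, x, y] := by
    have hfw : f ≠ w := fun hfw => hP.bd (hfw ▸ hyf.symm)
    have hfx : f ≠ x := fun hfx => hP.ac (hfx ▸ huf)
    simp [huf.ne', hfw, hfx, hyf.ne']
  have hfw : G.Adj f w := hG.adj_second_of_adj_first hP hfP huf.symm
  have hfx : G.Adj f x := (hG.adj_second_iff_adj_third hP hfP).1 hfw
  have hyw : y ∉ closedNbhd G w := not_or.2 ⟨hP.bd_ne.symm, hP.bd⟩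
  obtain ⟨v, hwv, hvf⟩ := hw.exists_adj_notMem hfw.symm hyf.symm hyw
  have hvP : v ∉ [u, w, x, y] := by
    have ne_of_adj : ∀ {q}, G.Adj f q → v ≠ q := fun hfq hvq => hvf (hvq ▸ .inr hfq)
    simp [ne_of_adj huf.symm, ne_of_adj hfw, ne_of_adj hfx, ne_of_adj hyf.symm]
  by_cases hvu : G.Adj v u
  · have hvy : G.Adj v y := (hG.adj_first_iff_adj_fourth hP hvP).1 hvu
    obtain ⟨p, hpu, hpf, hpy, -⟩ := h.exists_center_of_isInducedC4
      ⟨huf, hyf.symm, hvy.symm, hvu, hP.ad, fun hfv => hvf (.inr hfv), hP.ad_ne,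
        fun hfv => hvf (.inl hfv.symm)⟩
    exact ⟨p, hpu, hpf, hpy⟩
  · have hvx : G.Adj v x := (hG.adj_second_iff_adj_third hP hvP).1 hwv.symm
    have hux : u ∉ closedNbhd G x := not_or.2 ⟨hP.ac_ne, fun hxu => hP.ac hxu.symm⟩
    obtain ⟨p, hpf, hpy, hpu⟩ := h.exists_center_of_sun hP.bc hfx.symm hfw.symm
      ⟨⟨hP.cd, hyf.symm⟩, hyw⟩ ⟨⟨hP.ab.symm, huf.symm⟩, hux⟩ ⟨⟨hwv, hvx.symm⟩, hvf⟩
    exact ⟨p, hpu, hpf, hpy⟩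

theorem commonNeighbors_eq_empty (h : IsTreeSpanner G 2 T) (hG : IsP4Sparse G)
    (hw : IsClosedNbhdMaximal G w) (hP : IsInducedP4 G u w x y) : G.commonNeighbors u y = ∅ := by
  refine Set.eq_empty_of_forall_notMem fun f hf => ?_
  obtain ⟨p, hpu, -, hpy⟩ := h.exists_center_of_mem_commonNeighbors hG hw hP hf
  obtain ⟨q, hqu, hqp, -⟩ := h.exists_center_of_mem_commonNeighbors hG hw hP
    ⟨h.1 hpu.symm, h.1 hpy.symm⟩
  -- The tree would contain the triangle `u`, `p`, `q`.
  simpa using h.length_le_of_isChain (h.1 hpu)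
    (.cons hpu (.cons hqu.symm (.cons hqp (.cons hpu .nil))))
    (by simp [hpu.ne, hqu.ne, hqp.ne', hqu.ne', hqp.ne, hpu.ne'])

theorem hasUniversalVertex_or_isThinSpider [Finite V] (h : IsTreeSpanner G 2 T)
    (hG : IsP4Sparse G) : HasUniversalVertex G ∨ IsThinSpider G := by
  have hconn : G.Connected := h.2.1.connected.mono h.1
  have := hconn.nonempty
  obtain ⟨w, hw⟩ := exists_isClosedNbhdMaximal G
  by_cases huniv : ∀ y, y ∈ closedNbhd G w
  · exact .inl ⟨w, fun y hyw => (huniv y).resolve_left hyw⟩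
  push Not at huniv
  obtain ⟨z, hz⟩ := huniv
  obtain ⟨x, rfl | hwx, y, hy, hxy⟩ :=
    exists_adj_of_mem_of_notMem hconn.preconnected self_mem_closedNbhd hz
  · exact absurd (.inr hxy) hy
  obtain ⟨u, hwu, hux⟩ := hw.exists_adj_notMem hwx hxy hy
  obtain ⟨hyw_ne, hwy⟩ := not_or.1 hy
  obtain ⟨hux_ne, hxu⟩ := not_or.1 hux
  have hux' : ¬ G.Adj u x := fun hux' => hxu hux'.symm
  by_cases huy : G.Adj u y
  · exact absurd ⟨hwu.symm, hwx, hxy, huy.symm, hux', hwy, hux_ne, Ne.symm hyw_ne⟩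
      (h.not_isInducedC4_of_isClosedNbhdMaximal hG hw)
  · have hP : IsInducedP4 G u w x y := ⟨hwu.symm, hwx, hxy, hux', hwy, huy⟩
    exact hG.hasUniversalVertex_or_isThinSpider_of_pendant hconn.preconnected
      (hG.neighborSet_first_eq hP (h.commonNeighbors_eq_empty hG hw hP))

end IsTreeSpanner

end Maximality

section Admissible

variable {V : Type*} {G T : SimpleGraph V}

theorem isTreeSpanner_of_forall_adj {t : ℕ} (hle : T ≤ G) (hT : T.IsTree)
    (hdist : ∀ u v, G.Adj u v → T.dist u v ≤ t) : IsTreeSpanner G t T := by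
  have dist_le_length : ∀ {u v} (p : G.Walk u v), T.dist u v ≤ t * p.length := by
    intro u v p
    induction p with
    | nil => simp
    | @cons u v w huv p ih =>
      calc T.dist u w ≤ T.dist u v + T.dist v w := hT.connected.dist_triangle
        _ ≤ t + t * p.length := add_le_add (hdist u v huv) ih
        _ = t * (p.cons huv).length := by rw [SimpleGraph.Walk.length_cons]; ring
  refine ⟨hle, hT, fun u v => ?_⟩
  obtain ⟨p, hp⟩ := (hT.connected.mono hle).exists_walk_length_eq_dist u v
  exact hp ▸ dist_le_length p

theorem isAdmissible_two_of_forall_adj_or_pendant {r : V}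
    (hr : ∀ v ≠ r, G.Adj r v ∨ ∃ k, G.Adj r k ∧ G.neighborSet v = {k}) : IsAdmissible G 2 := by
  have hconn : G.Connected := by
    refine (SimpleGraph.connected_iff_exists_forall_reachable G).2 ⟨r, fun v => ?_⟩
    by_cases hvr : v = r
    · exact hvr ▸ .refl _
    rcases hr v hvr with hrv | ⟨k, hrk, hvk⟩
    · exact hrv.reachable
    · have hkv : G.Adj v k := hvk.superset rfl
      exact hrk.reachable.trans hkv.symm.reachable
  obtain ⟨T, hstar, hle, hT⟩ := hconn.exists_isTree_le_of_le_of_isAcyclic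
    (H := G ⊓ SimpleGraph.starGraph r) inf_le_left
    ((SimpleGraph.isAcyclic_starGraph r).anti inf_le_right)
  have adj_center : ∀ {v}, G.Adj r v → T.Adj r v := fun hrv =>
    hstar ⟨hrv, SimpleGraph.starGraph_center_adj hrv.ne⟩
  have adj_or_adj_center : ∀ {u v}, G.Adj u v → T.Adj u v ∨ T.Adj r u := by
    intro u v huv
    by_cases hur : u = r
    · subst hur
      exact .inl (adj_center huv)
    rcases hr u hur with hru | ⟨k, -, huk⟩
    · exact .inr (adj_center hru)
    · have : Nontrivial V := ⟨u, r, hur⟩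
      obtain ⟨w, huw⟩ := hT.connected.preconnected.exists_adj_of_nontrivial u
      have hwk : w = k := huk.subset (hle huw)
      have hvk : v = k := huk.subset huv
      exact .inl (hvk ▸ hwk ▸ huw)
  refine ⟨T, isTreeSpanner_of_forall_adj hle hT fun u v huv => ?_⟩
  rcases adj_or_adj_center huv with huv' | hru
  · exact (SimpleGraph.dist_le (.cons huv' .nil)).trans one_le_two
  rcases adj_or_adj_center huv.symm with hvu' | hrv
  · exact (SimpleGraph.dist_le (.cons hvu'.symm .nil)).trans one_le_two
  · exact SimpleGraph.dist_le (.cons hru.symm (.cons hrv .nil))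

theorem HasUniversalVertex.isAdmissible_two (h : HasUniversalVertex G) : IsAdmissible G 2 := by
  obtain ⟨r, hr⟩ := h
  exact isAdmissible_two_of_forall_adj_or_pendant fun v hv => .inl (hr v hv)

theorem IsLegMap.isAdmissible_two {S : Set V} {f : V → V} (h : IsLegMap G S f) :
    IsAdmissible G 2 := by
  obtain ⟨s, hs⟩ := h.nontrivial.nonempty
  refine isAdmissible_two_of_forall_adj_or_pendant (r := f s) fun v hv => ?_
  by_cases hvS : v ∈ S
  · by_cases hvs : v = s
    · exact .inl (hvs ▸ (h.adj_apply hs).symm)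
    · have hne : f s ≠ f v := h.injOn.ne hs hvS (Ne.symm hvs)
      exact .inr ⟨f v, h.adj v hvS (f s) (h.notMem s hs) hne, h.neighborSet_eq v hvS⟩
  · exact .inl (h.adj s hs v hvS hv).symm

theorem IsP4Sparse.isAdmissible_two_iff [Finite V] (hG : IsP4Sparse G) :
    IsAdmissible G 2 ↔ HasUniversalVertex G ∨ IsThinSpider G := by
  constructor
  · rintro ⟨T, hT⟩
    exact hT.hasUniversalVertex_or_isThinSpider hG
  · rintro (hU | hS)
    · exact hU.isAdmissible_two
    · obtain ⟨S, f, hSf⟩ := hS.exists_isLegMap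
      exact hSf.isAdmissible_two

end Admissible

/-! ### Degree sequences -/

section Degrees

variable {V : Type*} [Fintype V] {G : SimpleGraph V} [DecidableRel G.Adj]

/-- The number of vertices of degree `d`. -/
def degreeCount (G : SimpleGraph V) [DecidableRel G.Adj] (d : ℕ) : ℕ :=
  Finset.card {v | G.degree v = d}

theorem hasUniversalVertex_iff_degreeCount :
    HasUniversalVertex G ↔ 0 < degreeCount G (Fintype.card V - 1) := by
  simp [degreeCount, Finset.card_pos, Finset.filter_nonempty_iff, HasUniversalVertex,
    SimpleGraph.IsUniversal, ne_comm]

theorem degree_eq_one_of_neighborSet_eq_singleton {v w : V} (h : G.neighborSet v = {w}) :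
    G.degree v = 1 := by
  simp [← SimpleGraph.card_neighborSet_eq_degree, h]

namespace IsLegMap

variable {S : Finset V} {f : V → V}

theorem degree_apply (h : IsLegMap G S f) {s : V} (hs : s ∈ S) :
    G.degree (f s) = Fintype.card V - S.card := by
  classical
  have hneighbor : G.neighborFinset (f s) = insert s (Sᶜ.erase (f s)) := by
    ext v
    simp only [SimpleGraph.mem_neighborFinset, Finset.mem_insert, Finset.mem_erase,
      Finset.mem_compl]
    constructor
    · intro hv
      by_cases hvS : v ∈ S
      · exact .inl (h.injOn hvS hs (h.eq_of_adj hvS hv.symm).symm)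
      · exact .inr ⟨hv.ne', hvS⟩
    · rintro (rfl | ⟨hne, hvS⟩)
      exacts [(h.adj_apply hs).symm, (h.adj s hs v hvS hne).symm]
  have hfs : f s ∈ Sᶜ := Finset.mem_compl.2 (h.notMem s hs)
  rw [← SimpleGraph.card_neighborFinset_eq_degree, hneighbor,
    Finset.card_insert_of_notMem (by simp [hs]), Finset.card_erase_add_one hfs,
    Finset.card_compl]

theorem one_lt_degree (h : IsLegMap G S f) {v : V} (hv : v ∉ S) : 1 < G.degree v := by
  have exists_adj : ∀ s ∈ S, ∃ x, G.Adj v x ∧ (x = s ∨ x = f s) := by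
    intro s hs
    by_cases hvs : v = f s
    exacts [⟨s, hvs ▸ (h.adj_apply hs).symm, .inl rfl⟩, ⟨f s, h.adj s hs v hv hvs, .inr rfl⟩]
  obtain ⟨s, hs, t, ht, hst⟩ := h.nontrivial
  obtain ⟨x, hvx, hx⟩ := exists_adj s hs
  obtain ⟨y, hvy, hy⟩ := exists_adj t ht
  have hxy : x ≠ y := by
    have hne : f s ≠ f t := h.injOn.ne hs ht hst
    have hsft : s ≠ f t := fun e => h.notMem t ht (e ▸ hs)
    have hfst : f s ≠ t := fun e => h.notMem s hs (e ▸ ht)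
    rcases hx with rfl | rfl <;> rcases hy with rfl | rfl <;> assumption
  rw [← SimpleGraph.card_neighborFinset_eq_degree]
  exact Finset.one_lt_card.2 ⟨x, by simpa using hvx, y, by simpa using hvy, hxy⟩

theorem degree_eq_one_iff (h : IsLegMap G S f) {v : V} : G.degree v = 1 ↔ v ∈ S := by
  refine ⟨fun hv => ?_, fun hv => degree_eq_one_of_neighborSet_eq_singleton (h.neighborSet_eq v hv)⟩
  by_contra hvS
  exact (h.one_lt_degree hvS).ne' hv

theorem degreeCount_one (h : IsLegMap G S f) : degreeCount G 1 = S.card :=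
  congrArg Finset.card (Finset.ext fun v => by simpa using h.degree_eq_one_iff)

theorem card_le_degreeCount (h : IsLegMap G S f) :
    S.card ≤ degreeCount G (Fintype.card V - S.card) :=
  Finset.card_le_card_of_injOn f (fun s hs => by simpa using h.degree_apply hs) h.injOn

end IsLegMap

section Converse

variable {S : Finset V} {v : V}

theorem exists_mem_adj_of_degree_eq (hv : v ∉ S) (hdeg : G.degree v = Fintype.card V - S.card) :
    ∃ s ∈ S, G.Adj v s := by
  classical
  by_contra! hnot
  have hsub : G.neighborFinset v ⊆ Sᶜ.erase v := fun w hw => by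
    have hvw : G.Adj v w := (G.mem_neighborFinset v w).1 hw
    exact Finset.mem_erase.2 ⟨hvw.ne', Finset.mem_compl.2 fun hwS => hnot w hwS hvw⟩
  have hlt : (Sᶜ.erase v).card < Sᶜ.card := Finset.card_erase_lt_of_mem (Finset.mem_compl.2 hv)
  have hle : G.degree v ≤ (Sᶜ.erase v).card := Finset.card_le_card hsub
  rw [Finset.card_compl] at hlt
  omega

theorem adj_of_degree_eq (hv : v ∉ S) (hdeg : G.degree v = Fintype.card V - S.card) {s : V}
    (hs : ∀ t ∈ S, G.Adj v t → t = s) {w : V} (hw : w ∉ S) (hwv : w ≠ v) : G.Adj v w := by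
  classical
  by_contra hvw
  have hsub : G.neighborFinset v ⊆ insert s ((Sᶜ.erase v).erase w) := fun x hx => by
    have hvx : G.Adj v x := (G.mem_neighborFinset v x).1 hx
    have hxw : x ≠ w := fun hxw => hvw (hxw ▸ hvx)
    by_cases hxS : x ∈ S
    · exact Finset.mem_insert.2 (.inl (hs x hxS hvx))
    · simp [hxw, hvx.ne', hxS]
  have hle : G.degree v ≤ ((Sᶜ.erase v).erase w).card + 1 :=
    (Finset.card_le_card hsub).trans (Finset.card_insert_le _ _)
  have hcard : ((Sᶜ.erase v).erase w).card + 1 + 1 = Fintype.card V - S.card := by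
    rw [Finset.card_erase_add_one (by simp [hw, hwv]), Finset.card_erase_add_one (by simp [hv]),
      Finset.card_compl]
  omega

end Converse

theorem exists_isLegMap_of_degreeCount (htwo : 2 ≤ degreeCount G 1)
    (hne : Fintype.card V - degreeCount G 1 ≠ 1)
    (hle : degreeCount G 1 ≤ degreeCount G (Fintype.card V - degreeCount G 1)) :
    ∃ S f, IsLegMap G S f := by
  classical
  set S : Finset V := {v | G.degree v = 1} with hS
  set K : Finset V := {v | G.degree v = Fintype.card V - S.card} with hK
  have mem_S : ∀ {v}, v ∈ S ↔ G.degree v = 1 := by simp [hS]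
  have mem_K : ∀ {v}, v ∈ K ↔ G.degree v = Fintype.card V - S.card := by simp [hK]
  have notMem_of_mem_K : ∀ {v}, v ∈ K → v ∉ S := fun hvK hvS =>
    hne ((mem_K.1 hvK).symm.trans (mem_S.1 hvS))
  have exists_neighbor : ∀ s ∈ S, ∃ k, G.neighborSet s = {k} := fun s hs => by
    obtain ⟨k, hsk, hunique⟩ := SimpleGraph.degree_eq_one_iff_existsUnique_adj.1 (mem_S.1 hs)
    exact ⟨k, Set.eq_singleton_iff_unique_mem.2 ⟨hsk, hunique⟩⟩
  choose! f hf using exists_neighbor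
  have eq_of_adj : ∀ {s v}, s ∈ S → G.Adj v s → v = f s := fun hs hvs =>
    (hf _ hs).subset hvs.symm
  have K_subset : K ⊆ S.image f := fun v hv => by
    obtain ⟨s, hs, hvs⟩ := exists_mem_adj_of_degree_eq (notMem_of_mem_K hv) (mem_K.1 hv)
    exact Finset.mem_image.2 ⟨s, hs, (eq_of_adj hs hvs).symm⟩
  have image_eq : K = S.image f :=
    Finset.eq_of_subset_of_card_le K_subset (Finset.card_image_le.trans hle)
  have injOn : Set.InjOn f S :=
    Finset.card_image_iff.1 (Finset.card_image_le.antisymm (hle.trans_eq (congrArg _ image_eq)))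
  have apply_mem_K : ∀ s ∈ S, f s ∈ K := fun s hs => image_eq ▸ Finset.mem_image_of_mem f hs
  refine ⟨S, f, Finset.one_lt_card_iff_nontrivial.1 htwo, injOn,
    fun s hs => notMem_of_mem_K (apply_mem_K s hs), hf, fun s hs v hv hne => ?_⟩
  exact (adj_of_degree_eq (notMem_of_mem_K (apply_mem_K s hs)) (mem_K.1 (apply_mem_K s hs))
    (fun t ht hst => injOn ht hs (eq_of_adj ht hst).symm) hv hne).symm

theorem isThinSpider_iff_degreeCount :
    IsThinSpider G ↔ 2 ≤ degreeCount G 1 ∧ Fintype.card V - degreeCount G 1 ≠ 1 ∧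
      degreeCount G 1 ≤ degreeCount G (Fintype.card V - degreeCount G 1) := by
  classical
  constructor
  · intro hG
    obtain ⟨A, f, hf⟩ := hG.exists_isLegMap
    obtain ⟨S, rfl⟩ : ∃ S : Finset V, (S : Set V) = A := ⟨A.toFinset, A.coe_toFinset⟩
    obtain ⟨s, hs⟩ := hf.nontrivial.nonempty
    rw [hf.degreeCount_one]
    refine ⟨Finset.one_lt_card_iff_nontrivial.2 hf.nontrivial, ?_, hf.card_le_degreeCount⟩
    rw [← hf.degree_apply hs]
    exact hf.degree_eq_one_iff.not.2 (hf.notMem s hs)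
  · rintro ⟨htwo, hne, hle⟩
    obtain ⟨S, f, hf⟩ := exists_isLegMap_of_degreeCount htwo hne hle
    exact hf.isThinSpider

end Degrees

/-! ### Counting degrees by a program -/

section Machine

variable {n : ℕ} {G : SimpleGraph (Fin n)} {A : AdjacencyLists G} {P : Program}

theorem AdjacencyLists.degreeAt_eq_degree [DecidableRel G.Adj] (A : AdjacencyLists G) (v : Fin n) :
    A.degreeAt v = G.degree v := by
  have hneighbor : G.neighborFinset v = (A.nbrs v).toFinset := by
    ext w
    simp [A.mem_nbrs]
  rw [← SimpleGraph.card_neighborFinset_eq_degree, hneighbor,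
    List.toFinset_card_of_nodup (A.nodup v)]
  simp [degreeAt]

theorem AdjacencyLists.count_degreeAt_eq_degreeCount [DecidableRel G.Adj] (A : AdjacencyLists G)
    (d : ℕ) : Nat.count (A.degreeAt · = d) n = degreeCount G d := by
  rw [Nat.count_eq_card_filter_range, degreeCount, Finset.card_filter, Finset.card_filter,
    Finset.sum_range]
  simp only [A.degreeAt_eq_degree]

/-- Within `t` steps the program gets from configuration `c` to configuration `c'`. -/
def Reaches (P : Program) (A : AdjacencyLists G) (t : ℕ) (c c' : Config) : Prop :=
  ∃ s ≤ t, ∀ m, P.run A (m + s) c = P.run A m c'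

theorem Program.run_add_eq_some {t : ℕ} {c : Config} {b : Bool} (h : P.run A t c = some b)
    (s : ℕ) : P.run A (t + s) c = some b := by
  induction t generalizing c with
  | zero => simp [Program.run] at h
  | succ t ih =>
    rw [Nat.succ_add]
    unfold Program.run at h ⊢
    split at h <;> simp_all

namespace Reaches

variable {t t' : ℕ} {c c' c'' : Config}

theorem trans (h : Reaches P A t c c') (h' : Reaches P A t' c' c'') :
    Reaches P A (t + t') c c'' := by
  obtain ⟨s, hs, hrun⟩ := h
  obtain ⟨s', hs', hrun'⟩ := h'
  refine ⟨s + s', Nat.add_le_add hs hs', fun m => ?_⟩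
  rw [← hrun' m, ← hrun, add_assoc, add_comm s']

theorem mono (h : Reaches P A t c c') (ht : t ≤ t') : Reaches P A t' c c' :=
  let ⟨s, hs, hrun⟩ := h
  ⟨s, hs.trans ht, hrun⟩

theorem decidesWithin {p : Prop} {b : Bool} (h : Reaches P A t Config.init c)
    (hc : P[c.pc]? = some (.halt b)) (ht : t < t') (hb : b = true ↔ p) :
    P.DecidesWithin A t' p := by
  obtain ⟨s, hs, hrun⟩ := h
  obtain ⟨r, rfl⟩ := Nat.exists_eq_add_of_le (show 1 + s ≤ t' by omega)
  refine ⟨b, Program.run_add_eq_some ?_ r, hb⟩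
  rw [hrun]
  simp [Program.run, hc]

end Reaches

/-- A piece of code, to be placed at address `p`, that counts in `X 4` the vertices of degree `X 3`
and in `X 5` the other vertices. It expects the number of vertices in `X 0`, and uses `X 1` for the
current vertex and `X 2` for its degree. -/
def countDegree (p : ℕ) : Program :=
  [.const 1 0, .const 4 0, .const 5 0,
    .jumpEq 1 0 (p + 11), .degree 2 1, .jumpEq 2 3 (p + 8), .incr 5, .jump (p + 9), .incr 4,
    .incr 1, .jump (p + 3)]

/-- Relates the memory `M₀` before `countDegree` to the memory `M` at a time when it has handled the
vertices below `j`. -/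
structure HasCounted (A : AdjacencyLists G) (M₀ : ℕ → ℕ) (j : ℕ) (M : ℕ → ℕ) : Prop where
  vertex : M 1 = j
  hits : M 4 = Nat.count (A.degreeAt · = M₀ 3) j
  hits_add_misses : M 4 + M 5 = j
  unchanged : ∀ i ∉ ({1, 2, 4, 5} : Finset ℕ), M i = M₀ i

theorem getElem?_of_isPrefix_drop {p : ℕ} (hP : countDegree p <+: P.drop p) (i : ℕ)
    (hi : i < 11) :
    P[p + i]? = (countDegree p)[i]? := by
  rw [← List.getElem?_drop, List.prefix_iff_getElem?.1 hP i hi, List.getElem?_eq_getElem hi]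

namespace HasCounted

variable {p j k : ℕ} {M₀ M : ℕ → ℕ}

open Function in
theorem step (hP : countDegree p <+: P.drop p) (h : HasCounted A M₀ j M) (hM₀ : M₀ 0 = n)
    (hj : j ≠ n) :
    ∃ M', HasCounted A M₀ (j + 1) M' ∧ Reaches P A 7 ⟨p + 3, M⟩ ⟨p + 3, M'⟩ := by
  obtain ⟨vertex, hits, add, unchanged⟩ := h
  have hM0 : M 0 = n := (unchanged 0 (by simp)).trans hM₀
  have hM3 : M 3 = M₀ 3 := unchanged 3 (by simp)
  have code := getElem?_of_isPrefix_drop hP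
  by_cases hit : A.degreeAt j = M₀ 3
  · refine ⟨update (update (update M 2 (M₀ 3)) 4 (M 4 + 1)) 1 (j + 1), ?_, 6, by simp,
      fun m => ?_⟩
    · exact ⟨by simp, by simp [hits, Nat.count_succ, hit], by simp [Nat.add_right_comm _ 1, add],
        by simp +contextual [unchanged]⟩
    · simp [Program.run, code, countDegree, add_assoc, Instr.exec, Config.write, vertex, hM0, hM3,
        hj, hit]
  · refine ⟨update (update (update M 2 (A.degreeAt j)) 5 (M 5 + 1)) 1 (j + 1), ?_, 7, le_rfl,
      fun m => ?_⟩
    · exact ⟨by simp, by simp [hits, Nat.count_succ, hit], by simp [← add_assoc, add],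
        by simp +contextual [unchanged]⟩
    · simp [Program.run, code, countDegree, add_assoc, Instr.exec, Config.write, vertex, hM0, hM3,
        hj, hit]

theorem reaches_exit (hP : countDegree p <+: P.drop p) (h : HasCounted A M₀ n M)
    (hM₀ : M₀ 0 = n) : Reaches P A 1 ⟨p + 3, M⟩ ⟨p + 11, M⟩ := by
  have hM0 : M 0 = n := (h.unchanged 0 (by simp)).trans hM₀
  have code := getElem?_of_isPrefix_drop hP 3 (by simp)
  refine ⟨1, le_rfl, fun m => ?_⟩
  simp [Program.run, code, countDegree, Instr.exec, h.vertex, hM0]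

theorem reaches_of_add_eq (hP : countDegree p <+: P.drop p) (h : HasCounted A M₀ j M)
    (hM₀ : M₀ 0 = n) (hjk : j + k = n) :
    ∃ M', HasCounted A M₀ n M' ∧ Reaches P A (7 * k + 1) ⟨p + 3, M⟩ ⟨p + 11, M'⟩ := by
  induction k generalizing j M with
  | zero =>
    obtain rfl : j = n := hjk
    exact ⟨M, h, h.reaches_exit hP hM₀⟩
  | succ k ih =>
    obtain ⟨M₁, hM₁, hstep⟩ := h.step hP hM₀ (by omega)
    obtain ⟨M₂, hM₂, hreaches⟩ := ih hM₁ (by omega)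
    exact ⟨M₂, hM₂, (hstep.trans hreaches).mono (by omega)⟩

theorem hits_eq_degreeCount [DecidableRel G.Adj] (h : HasCounted A M₀ n M) :
    M 4 = degreeCount G (M₀ 3) :=
  h.hits.trans (A.count_degreeAt_eq_degreeCount _)

theorem misses_eq [DecidableRel G.Adj] (h : HasCounted A M₀ n M) :
    M 5 = n - degreeCount G (M₀ 3) := by
  rw [← h.hits_eq_degreeCount, ← h.hits_add_misses, Nat.add_sub_cancel_left]

end HasCounted

open Function in
theorem exists_hasCounted (A : AdjacencyLists G) {p : ℕ} (hP : countDegree p <+: P.drop p)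
    {M : ℕ → ℕ} (hM : M 0 = n) :
    ∃ M', HasCounted A M n M' ∧ Reaches P A (7 * n + 4) ⟨p, M⟩ ⟨p + 11, M'⟩ := by
  have code := getElem?_of_isPrefix_drop hP
  have code_zero : P[p]? = some (.const 1 0) := code 0 (by simp)
  have hinit : Reaches P A 3 ⟨p, M⟩ ⟨p + 3, update (update (update M 1 0) 4 0) 5 0⟩ := by
    refine ⟨3, le_rfl, fun m => ?_⟩
    simp [Program.run, code, code_zero, countDegree, add_assoc, Instr.exec, Config.write]
  have hzero : HasCounted A M 0 (update (update (update M 1 0) 4 0) 5 0) := by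
    constructor <;> simp +contextual
  obtain ⟨M', hM', hreaches⟩ := hzero.reaches_of_add_eq hP hM (Nat.zero_add n)
  exact ⟨M', hM', (hinit.trans hreaches).mono (by omega)⟩

/-- Accepts if some vertex has degree `n - 1`. Otherwise it counts the `k` vertices of degree `1`,
stores `k` in `X 8` and `n - k` in `X 3`, rejects if `n - k = 1` or `k < 2`, and finally compares
`k` with the number of vertices of degree `n - k`. -/
def degreeProgram : Program :=
  [.order 0, .order 3, .decr 3] ++ countDegree 3 ++
  [.jumpLt 6 4 45, .const 3 1] ++ countDegree 16 ++
  [.copy 8 4, .copy 3 5, .const 6 1, .const 7 2, .jumpEq 3 6 46, .jumpLt 8 7 46] ++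
  countDegree 33 ++ [.jumpLt 4 8 46, .halt true, .halt false]

theorem degreeProgram_usesOnlyDegrees : degreeProgram.UsesOnlyDegrees := by
  simp [Program.UsesOnlyDegrees, degreeProgram, countDegree]

section Stages

variable {M : ℕ → ℕ}

open Classical Function in
theorem exists_reaches_ite_hasUniversalVertex (A : AdjacencyLists G) :
    ∃ M, M 0 = n ∧ Reaches degreeProgram A (7 * n + 8) Config.init
      ⟨if HasUniversalVertex G then 45 else 15, M⟩ := by
  let M₀ : ℕ → ℕ := update (update (fun _ => 0) 0 n) 3 (n - 1)
  have hinit : Reaches degreeProgram A 3 Config.init ⟨3, M₀⟩ := by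
    refine ⟨3, le_rfl, fun m => ?_⟩
    simp [Program.run, degreeProgram, Instr.exec, Config.write, Config.init, M₀]
  obtain ⟨M, hM, hcount⟩ :=
    exists_hasCounted A (P := degreeProgram) (p := 3) ⟨_, rfl⟩ (M := M₀) rfl
  have hM4 : M 4 = degreeCount G (n - 1) := hM.hits_eq_degreeCount
  have hM6 : M 6 = 0 := hM.unchanged 6 (by simp)
  have htest : Reaches degreeProgram A 1 ⟨14, M⟩
      ⟨if HasUniversalVertex G then 45 else 15, M⟩ := by
    refine ⟨1, le_rfl, fun m => ?_⟩
    simp [Program.run, degreeProgram, countDegree, Instr.exec, hM4, hM6,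
      hasUniversalVertex_iff_degreeCount]
  exact ⟨M, hM.unchanged 0 (by simp), ((hinit.trans hcount).trans htest).mono (by omega)⟩

open Function in
theorem exists_reaches_ite_degreeCount_one [DecidableRel G.Adj] (A : AdjacencyLists G)
    (hM : M 0 = n) :
    ∃ M', M' 0 = n ∧ M' 3 = n - degreeCount G 1 ∧ M' 8 = degreeCount G 1 ∧
      Reaches degreeProgram A (7 * n + 11) ⟨15, M⟩
        ⟨if 2 ≤ degreeCount G 1 ∧ n - degreeCount G 1 ≠ 1 then 33 else 46, M'⟩ := by
  set k := degreeCount G 1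
  have hinit : Reaches degreeProgram A 1 ⟨15, M⟩ ⟨16, update M 3 1⟩ := by
    refine ⟨1, le_rfl, fun m => ?_⟩
    simp [Program.run, degreeProgram, countDegree, Instr.exec, Config.write]
  obtain ⟨M₁, hM₁, hcount⟩ :=
    exists_hasCounted A (P := degreeProgram) (p := 16) ⟨_, rfl⟩ (M := update M 3 1) hM
  have hM₁0 : M₁ 0 = n := (hM₁.unchanged 0 (by simp)).trans hM
  have hM₁4 : M₁ 4 = k := hM₁.hits_eq_degreeCount
  have hM₁5 : M₁ 5 = n - k := hM₁.misses_eq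
  let M₂ : ℕ → ℕ := update (update (update (update M₁ 8 k) 3 (n - k)) 6 1) 7 2
  have htest : Reaches degreeProgram A 6 ⟨27, M₁⟩
      ⟨if 2 ≤ k ∧ n - k ≠ 1 then 33 else 46, M₂⟩ := by
    by_cases hne : n - k = 1
    · refine ⟨5, by simp, fun m => ?_⟩
      simp [Program.run, degreeProgram, countDegree, Instr.exec, Config.write, hM₁4, hM₁5, M₂, hne]
    · refine ⟨6, le_rfl, fun m => ?_⟩
      rcases Nat.lt_or_ge k 2 with hk | hk <;>
        simp [Program.run, degreeProgram, countDegree, Instr.exec, Config.write, hM₁4, hM₁5, M₂,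
          hne, hk, Nat.not_le.2, Nat.not_lt.2]
  exact ⟨M₂, hM₁0, rfl, rfl, ((hinit.trans hcount).trans htest).mono (by omega)⟩

theorem exists_reaches_ite_le_degreeCount [DecidableRel G.Adj] (A : AdjacencyLists G)
    (hM : M 0 = n) :
    ∃ M', Reaches degreeProgram A (7 * n + 5) ⟨33, M⟩
      ⟨if M 8 ≤ degreeCount G (M 3) then 45 else 46, M'⟩ := by
  obtain ⟨M', hM', hcount⟩ := exists_hasCounted A (P := degreeProgram) (p := 33) ⟨_, rfl⟩ hM
  have hM4' : M' 4 = degreeCount G (M 3) := hM'.hits_eq_degreeCount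
  have hM8' : M' 8 = M 8 := hM'.unchanged 8 (by simp)
  refine ⟨M', hcount.trans ⟨1, le_rfl, fun m => ?_⟩⟩
  rcases Nat.lt_or_ge (degreeCount G (M 3)) (M 8) with h | h <;>
    simp [Program.run, degreeProgram, countDegree, Instr.exec, hM4', hM8', h, Nat.not_le.2,
      Nat.not_lt.2]

open Classical in
theorem exists_reaches_ite_isThinSpider (A : AdjacencyLists G) (hM : M 0 = n) :
    ∃ M', Reaches degreeProgram A (14 * n + 16) ⟨15, M⟩
      ⟨if IsThinSpider G then 45 else 46, M'⟩ := by
  obtain ⟨M₁, hM₁0, hM₁3, hM₁8, hleaves⟩ := exists_reaches_ite_degreeCount_one A hM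
  obtain ⟨M₂, hclique⟩ := exists_reaches_ite_le_degreeCount A hM₁0
  rw [hM₁3, hM₁8] at hclique
  by_cases h : 2 ≤ degreeCount G 1 ∧ n - degreeCount G 1 ≠ 1
  · rw [if_pos h] at hleaves
    have hreaches := (hleaves.trans hclique).mono (t' := 14 * n + 16) (by omega)
    exact ⟨M₂, by simpa [isThinSpider_iff_degreeCount, h] using hreaches⟩
  · rw [if_neg h] at hleaves
    have hspider : ¬ IsThinSpider G := fun hG =>
      h (by simpa using (and_assoc.2 (isThinSpider_iff_degreeCount.1 hG)).1)
    exact ⟨M₁, by simpa [hspider] using hleaves.mono (by omega)⟩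

end Stages

theorem degreeProgram_decidesWithin (A : AdjacencyLists G) :
    degreeProgram.DecidesWithin A (21 * n + 25) (HasUniversalVertex G ∨ IsThinSpider G) := by
  obtain ⟨M, hM, huniversal⟩ := exists_reaches_ite_hasUniversalVertex A
  obtain ⟨M', hspider⟩ := exists_reaches_ite_isThinSpider A hM
  by_cases hG : HasUniversalVertex G
  · rw [if_pos hG] at huniversal
    exact huniversal.decidesWithin (b := true) rfl (by omega) (by simp [hG])
  rw [if_neg hG] at huniversal
  have hreaches := huniversal.trans hspider
  by_cases hG' : IsThinSpider G
  · rw [if_pos hG'] at hreaches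
    exact hreaches.decidesWithin (b := true) rfl (by omega) (by simp [hG'])
  · rw [if_neg hG'] at hreaches
    exact hreaches.decidesWithin (b := false) rfl (by omega) (by simp [hG, hG'])

end Machine

end Admissibility

open Admissibility

theorem mainTheorem9_general :
    (∀ (V : Type*) [Finite V] (G : SimpleGraph V), IsP4Sparse G →
      (IsAdmissible G 2 ↔ HasUniversalVertex G ∨ IsThinSpider G)) ∧
    ∃ (P : Program) (T : ℕ → ℕ),
      P.UsesOnlyDegrees ∧
      Asymptotics.IsBigO Filter.atTop (fun n : ℕ => (T n : ℝ)) (fun n : ℕ => (n : ℝ)) ∧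
      ∀ (n : ℕ) (G : SimpleGraph (Fin n)) (A : AdjacencyLists G),
        P.DecidesWithin A (T n) (HasUniversalVertex G ∨ IsThinSpider G) := by
  refine ⟨fun V _ G hG => hG.isAdmissible_two_iff, degreeProgram, fun n => 21 * n + 25,
    degreeProgram_usesOnlyDegrees, ?_, fun n G A => degreeProgram_decidesWithin A⟩
  refine Asymptotics.IsBigO.of_bound 46 (Filter.eventually_atTop.2 ⟨1, fun n hn => ?_⟩)
  rw [Real.norm_natCast, Real.norm_natCast]
  exact_mod_cast show 21 * n + 25 ≤ 46 * n by omega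

theorem mainTheorem9 :
    (∀ (n : ℕ) (G : SimpleGraph (Fin n)), Admissibility.IsP4Sparse G →
      (Admissibility.IsAdmissible G 2 ↔
        Admissibility.HasUniversalVertex G ∨ Admissibility.IsThinSpider G)) ∧
    ∃ (P : Admissibility.Program) (T : ℕ → ℕ),
      P.UsesOnlyDegrees ∧
      Asymptotics.IsBigO Filter.atTop (fun n : ℕ => (T n : ℝ)) (fun n : ℕ => (n : ℝ)) ∧
      ∀ (n : ℕ) (G : SimpleGraph (Fin n)) (A : Admissibility.AdjacencyLists G),
        Admissibility.IsP4Sparse G →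
          P.DecidesWithin A (T n) (Admissibility.IsAdmissible G 2) := by
  obtain ⟨hiff, P, T, hdegrees, hlinear, hdecides⟩ := mainTheorem9_general.{0}
  refine ⟨fun n G => hiff (Fin n) G, P, T, hdegrees, hlinear, fun n G A hG => ?_⟩
  simpa only [hiff (Fin n) G hG] using hdecides n G A
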